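/- On $\mathbb{R}^6$ with coordinates $(x_1,x_2,y_1,y_2,z_1,z_2)$ consider $\xi=\ker\beta_1\cap\ker\beta_2$, where \[ \beta_1=dz_1-y_1\,dx_1-\frac{2y_2}{\pi(1+x_2^2)}\,dx_2-\Big(\frac{8}{3\pi^3}\arctan^3(x_2)+\frac{2}{\pi}\arctan(x_2)+2x_1\Big)dy_1, \] \[ \beta_2=dz_2-y_2\,dx_1-\frac{2y_1}{\pi(1+x_2^2)}\,dx_2 . \] For every point $q\in\mathbb{R}^6$ the germ of $\xi$ at $q$ has the following properties. (i) It is a fat corank-2 distribution germ. That is, near $q$, $\xi$ is the common kernel of two smooth pointwise linearly independent 1-forms, and at all points near $q$ the quadratic form $q_\xi(\psi,\psi)=(\psi\circ\mathcal L)\wedge(\psi\circ\mathcal L)\in\bigwedge^4\xi^*\cong\mathbb{R}$ on $Q^*$ is definite, where $Q=T\mathbb{R}^6/\xi$ and $\mathcal L:\bigwedge^2\xi\to Q$, $u\wedge v\mapsto[u,v]\bmod\xi$, is the curvature. (ii) $Z_1=\partial_{z_1}$ and $Z_2=\partial_{z_2}$ are Reeb directions for it. That is, near $q$ one can write $\xi=\ker\lambda_1\cap\ker\lambda_2$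 with smooth 1-forms $\lambda_1,\lambda_2$ such that $T\mathbb{R}^6=\xi\oplus\langle Z_1,Z_2\rangle$, $\lambda_i(Z_j)=\delta_{ij}$, $\iota_{Z_i}d\lambda_j|_\xi=0$ for $i,j\in\{1,2\}$, and $[Z_1,Z_2]=0$. (iii) No germ diffeomorphic to it supports a complex contact structure. That is, if the germ at $p$ of a distribution $D$ on a smooth 6-manifold $M$ is diffeomorphic to the germ of $\xi$ at $q$, then no neighbourhood of $p$ in $M$ carries a complex-manifold structure compatible with its smooth structure, together with a complex contact structure (a field of complex hyperplanes which is locally the kernel of a holomorphic 1-form $\theta$ with $\theta\wedge d\theta$ nowhere zero), whose underlying real distribution is $D$. Consequently Bhowmick's question has a negative answer: it is not true that every fat corank-2 distribution germ on $\mathbb{R}^6$ admitting Reeb directions is diffeomorphic to the germ of the real distribution underlying a complex contact structure. -/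

import Mathlib

open scoped Topology Manifold ContDiff

noncomputable section

/-- Real six-dimensional Euclidean space, with coordinates `(x₁, x₂, y₁, y₂, z₁, z₂)` numbered
`0, 1, 2, 3, 4, 5`. -/
abbrev R6 : Type := EuclideanSpace ℝ (Fin 6)

/-- Complex three-dimensional space. -/
abbrev C3 : Type := EuclideanSpace ℂ (Fin 3)

/-! ### Differential one-forms on a vector space -/

section Forms

variable {𝕜 : Type*} [NontriviallyNormedField 𝕜] {E : Type*} [NormedAddCommGroup E]
  [NormedSpace 𝕜 E]

/-- The value `dθ_x(u, v)` of the exterior derivative of the one-form `θ`. -/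
def extDerivOne (θ : E → E →L[𝕜] 𝕜) (x u v : E) : 𝕜 :=
  extDeriv (fun y => ContinuousAlternatingMap.ofSubsingleton 𝕜 E 𝕜 (0 : Fin 1) (θ y)) x ![u, v]

theorem extDerivOne_apply {θ : E → E →L[𝕜] 𝕜} {x : E} (h : DifferentiableAt 𝕜 θ x) (u v : E) :
    extDerivOne θ x u v = fderiv 𝕜 θ x u v - fderiv 𝕜 θ x v u := by
  let e : (E →L[𝕜] 𝕜) →L[𝕜] (E [⋀^Fin 1]→L[𝕜] 𝕜) :=
    (ContinuousAlternatingMap.ofSubsingletonLIE (𝕜 := 𝕜) (E := E) (F := 𝕜)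
      (0 : Fin 1)).toContinuousLinearEquiv.toContinuousLinearMap
  have h' : HasFDerivAt
      (fun y => ContinuousAlternatingMap.ofSubsingleton 𝕜 E 𝕜 (0 : Fin 1) (θ y))
      (e.comp (fderiv 𝕜 θ x)) x := e.hasFDerivAt.comp x h.hasFDerivAt
  rw [extDerivOne, extDeriv, h'.fderiv]
  have he : ∀ (f : E →L[𝕜] 𝕜) (w : Fin 1 → E), e f w = f (w 0) := fun _ _ => rfl
  simp [ContinuousAlternatingMap.alternatizeUncurryFin_apply, Fin.sum_univ_two, he,
    Fin.removeNth_apply, sub_eq_add_neg]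

/-- The value `(θ ∧ dθ)_x(u, v, w)`. -/
def wedgeExtDeriv (θ : E → E →L[𝕜] 𝕜) (x u v w : E) : 𝕜 :=
  θ x u * extDerivOne θ x v w - θ x v * extDerivOne θ x u w + θ x w * extDerivOne θ x u v

end Forms

/-! ### Corank-two distributions on `ℝ⁶`: curvature, fatness, Reeb directions -/

/-- On `U`, the field of subspaces `D` is the common kernel of the one-forms `lam 0`, `lam 1`. -/
def IsKernelOn (D : R6 → Submodule ℝ R6) (lam : Fin 2 → R6 → R6 →L[ℝ] ℝ) (U : Set R6) : Prop :=
  ∀ x ∈ U, D x = (lam 0 x).ker ⊓ (lam 1 x).ker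

/-- Near `q`, `D` is a smooth distribution of corank two, that is, the common kernel of two smooth,
pointwise linearly independent one-forms. -/
def IsCorankTwoGerm (D : R6 → Submodule ℝ R6) (q : R6) : Prop :=
  ∃ U : Set R6, IsOpen U ∧ q ∈ U ∧ ∃ lam : Fin 2 → R6 → R6 →L[ℝ] ℝ,
    (∀ i, ContDiffOn ℝ ∞ (lam i) U) ∧
    (∀ x ∈ U, LinearIndependent ℝ (fun i => lam i x)) ∧ IsKernelOn D lam U

/-- The vector field `u` restricts to a smooth section of `D` near `q`. -/
def IsLocalSection (D : R6 → Submodule ℝ R6) (q : R6) (u : R6 → R6) : Prop :=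
  ∃ U : Set R6, IsOpen U ∧ q ∈ U ∧ ContDiffOn ℝ ∞ u U ∧ ∀ x ∈ U, u x ∈ D x

/-- `L` is the curvature (Levi map) of `D` at `q`: `L(u(q), v(q)) = [u, v](q) mod D_q` for all local
sections `u`, `v` of `D`. For a smooth distribution of constant rank there is exactly one. -/
def IsCurvatureAt (D : R6 → Submodule ℝ R6) (q : R6)
    (L : D q →ₗ[ℝ] D q →ₗ[ℝ] (R6 ⧸ D q)) : Prop :=
  ∀ u v : R6 → R6, IsLocalSection D q u → IsLocalSection D q v → ∀ a b : D q,
    u q = a → v q = b → L a b = Submodule.Quotient.mk (VectorField.lieBracket ℝ u v q)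

/-- The wedge product `σ ∧ τ` of two alternating bilinear forms, evaluated at
`e 0, e 1, e 2, e 3`. -/
def wedgeTwoTwo {V : Type*} (σ τ : V → V → ℝ) (e : Fin 4 → V) : ℝ :=
  σ (e 0) (e 1) * τ (e 2) (e 3) - σ (e 0) (e 2) * τ (e 1) (e 3) + σ (e 0) (e 3) * τ (e 1) (e 2)
    + σ (e 1) (e 2) * τ (e 0) (e 3) - σ (e 1) (e 3) * τ (e 0) (e 2) + σ (e 2) (e 3) * τ (e 0) (e 1)

/-- The bilinear form `q_D(ψ, φ) = (ψ ∘ L) ∧ (φ ∘ L)` on the dual of the quotient, where the line of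
four-forms on the four-dimensional fibre is identified with `ℝ` by evaluation on a basis `e` (so `e`
plays the role of the chosen volume form). -/
def curvatureForm {W : Submodule ℝ R6} (L : W →ₗ[ℝ] W →ₗ[ℝ] (R6 ⧸ W)) (e : Module.Basis (Fin 4) ℝ W)
    (ψ φ : Module.Dual ℝ (R6 ⧸ W)) : ℝ :=
  wedgeTwoTwo (fun a b => ψ (L a b)) (fun a b => φ (L a b)) e

/-- The quadratic form `q_D` is definite at `q`, for every choice of volume form on `D_q`. -/
def IsEllipticAt (D : R6 → Submodule ℝ R6) (q : R6) : Prop :=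
  ∃ L : D q →ₗ[ℝ] D q →ₗ[ℝ] (R6 ⧸ D q), IsCurvatureAt D q L ∧
    ∀ e : Module.Basis (Fin 4) ℝ (D q),
      (∀ ψ : Module.Dual ℝ (R6 ⧸ D q), ψ ≠ 0 → 0 < curvatureForm L e ψ ψ) ∨
      (∀ ψ : Module.Dual ℝ (R6 ⧸ D q), ψ ≠ 0 → curvatureForm L e ψ ψ < 0)

/-- The germ of `D` at `q` is a fat (elliptic) corank-two distribution germ. -/
def IsFatGerm (D : R6 → Submodule ℝ R6) (q : R6) : Prop :=
  IsCorankTwoGerm D q ∧ ∀ᶠ x in 𝓝 q, IsEllipticAt D x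

/-- The vector fields `Z 0`, `Z 1` are Reeb directions of the corank-two distribution `D`
near `q`. -/
def HasReebDirections (D : R6 → Submodule ℝ R6) (Z : Fin 2 → R6 → R6) (q : R6) : Prop :=
  ∃ U : Set R6, IsOpen U ∧ q ∈ U ∧ (∀ i, ContDiffOn ℝ ∞ (Z i) U) ∧
    ∃ lam : Fin 2 → R6 → R6 →L[ℝ] ℝ, (∀ i, ContDiffOn ℝ ∞ (lam i) U) ∧ IsKernelOn D lam U ∧
      ∀ x ∈ U,
        IsCompl (D x) (Submodule.span ℝ (Set.range fun i => Z i x)) ∧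
        (∀ i j, lam i x (Z j x) = if i = j then 1 else 0) ∧
        (∀ i j, ∀ v ∈ D x, extDerivOne (lam j) x (Z i x) v = 0) ∧
        VectorField.lieBracket ℝ (Z 0) (Z 1) x = 0

/-! ### Complex contact structures and their underlying real distributions -/

/-- A field `H` of complex hyperplanes in the tangent spaces of the complex three-manifold `N` is a
complex contact structure: in the holomorphic chart around each point it is, near that point, the
kernel of a holomorphic one-form `θ` with `θ ∧ dθ` nowhere zero. -/
def IsComplexContact {N : Type*} [TopologicalSpace N] [ChartedSpace C3 N]
    (H : ∀ y : N, Submodule ℂ (TangentSpace 𝓘(ℂ, C3) y)) : Prop :=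
  ∀ y₀ : N, ∃ V : Set C3, IsOpen V ∧ chartAt C3 y₀ y₀ ∈ V ∧ V ⊆ (chartAt C3 y₀).target ∧
    ∃ θ : C3 → C3 →L[ℂ] ℂ, DifferentiableOn ℂ θ V ∧
      (∀ w ∈ V, ∃ a b c : C3, wedgeExtDeriv θ w a b c ≠ 0) ∧
      ∀ y ∈ (chartAt C3 y₀).source, chartAt C3 y₀ y ∈ V →
        ∀ v : TangentSpace 𝓘(ℂ, C3) y,
          v ∈ H y ↔ θ (chartAt C3 y₀ y) (mfderiv 𝓘(ℂ, C3) 𝓘(ℂ, C3) (chartAt C3 y₀) y v) = 0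

/-- The germ at `p` of the distribution `D` on the smooth six-manifold `M` supports a complex contact
structure: a smooth diffeomorphism `f` identifies a neighbourhood of `p` with an open subset of a
complex three-manifold `N` carrying a complex contact structure `H`, in such a way that `D` becomes
the real distribution underlying `H`. -/
def SupportsComplexContact.{u} {M : Type u} [TopologicalSpace M] [ChartedSpace R6 M]
    (D : ∀ x : M, Submodule ℝ (TangentSpace 𝓘(ℝ, R6) x)) (p : M) : Prop :=
  ∃ (N : Type u) (_ : TopologicalSpace N) (_ : ChartedSpace C3 N)
    (_ : IsManifold 𝓘(ℂ, C3) ω N) (H : ∀ y : N, Submodule ℂ (TangentSpace 𝓘(ℂ, C3) y))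
    (f : OpenPartialHomeomorph M N),
    IsComplexContact H ∧ p ∈ f.source ∧
    ContMDiffOn 𝓘(ℝ, R6) 𝓘(ℝ, C3) ∞ f f.source ∧
    ContMDiffOn 𝓘(ℝ, C3) 𝓘(ℝ, R6) ∞ f.symm f.target ∧
    ∀ x ∈ f.source, ∀ v : TangentSpace 𝓘(ℝ, R6) x,
      v ∈ D x ↔ (mfderiv 𝓘(ℝ, R6) 𝓘(ℝ, C3) f x v : C3) ∈ H (f x)

/-- The germ at `p` of the distribution `D` on `M` and the germ at `p'` of the distribution `D'`
on `M'` are diffeomorphic. -/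
def GermDiffeomorphic {M M' : Type*} [TopologicalSpace M] [ChartedSpace R6 M]
    [TopologicalSpace M'] [ChartedSpace R6 M']
    (D : ∀ x : M, Submodule ℝ (TangentSpace 𝓘(ℝ, R6) x)) (p : M)
    (D' : ∀ x : M', Submodule ℝ (TangentSpace 𝓘(ℝ, R6) x)) (p' : M') : Prop :=
  ∃ g : OpenPartialHomeomorph M M', p ∈ g.source ∧ g p = p' ∧
    ContMDiffOn 𝓘(ℝ, R6) 𝓘(ℝ, R6) ∞ g g.source ∧
    ContMDiffOn 𝓘(ℝ, R6) 𝓘(ℝ, R6) ∞ g.symm g.target ∧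
    ∀ x ∈ g.source, ∀ v : TangentSpace 𝓘(ℝ, R6) x,
      v ∈ D x ↔ mfderiv 𝓘(ℝ, R6) 𝓘(ℝ, R6) g x v ∈ D' (g x)

/-! ### The distribution -/

/-- The coordinate one-form `dcᵢ` on `ℝ⁶`, `c` running through `x₁, x₂, y₁, y₂, z₁, z₂`. -/
def dCoord (i : Fin 6) : R6 →L[ℝ] ℝ := EuclideanSpace.proj i

/-- The coordinate vector field `∂_{cᵢ}` on `ℝ⁶`. -/
def coordField (i : Fin 6) : R6 → R6 := fun _ => EuclideanSpace.single i 1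

/-- `β₁ = dz₁ - y₁ dx₁ - 2y₂/(π(1+x₂²)) dx₂
  - (8/(3π³) arctan³ x₂ + (2/π) arctan x₂ + 2x₁) dy₁`. -/
def betaOne (p : R6) : R6 →L[ℝ] ℝ :=
  dCoord 4 - p 2 • dCoord 0 - (2 * p 3 / (Real.pi * (1 + p 1 ^ 2))) • dCoord 1
    - (8 / (3 * Real.pi ^ 3) * Real.arctan (p 1) ^ 3 + 2 / Real.pi * Real.arctan (p 1) + 2 * p 0)
      • dCoord 2

/-- `β₂ = dz₂ - y₂ dx₁ - 2y₁/(π(1+x₂²)) dx₂`. -/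
def betaTwo (p : R6) : R6 →L[ℝ] ℝ :=
  dCoord 5 - p 3 • dCoord 0 - (2 * p 2 / (Real.pi * (1 + p 1 ^ 2))) • dCoord 1

/-- The distribution `ξ = ker β₁ ∩ ker β₂`. -/
def xi (p : R6) : Submodule ℝ R6 := (betaOne p).ker ⊓ (betaTwo p).ker

end

noncomputable section

/-! Put t = (2/π) arctan x₂, so |t| < 1, and c = ∂t/∂x₂ > 0. On ξ the square of the two-form a dβ₁ +
b dβ₂ is a nonzero multiple of G = a² + b² - (1 + t²)ab. Since t² < 1, G is definite over ℝ, which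
is fatness. The coefficients of the βᵢ do not involve z, so the ∂_{zᵢ} are Reeb directions.

Suppose ξ is the kernel of F^*θ with θ holomorphic. Then F^*θ = aβ₁ + bβ₂ with complex functions a,
b, which vanish nowhere because ∂_{z₁}, ∂_{z₂} ∉ ξ. The kernel of θ is a complex plane, so ∑ dθ(uᵢ,
uⱼ) uₖ = 0, summed cyclically, for any three of its vectors (`cyclic_relation_of_mem_ker`). Pairing
with a fourth vector of the plane gives G = 0. For the horizontal lifts X₁, Y₁, X₂ of ∂_{x₁},
∂_{y₁}, ∂_{x₂}, the same relation says that dF, extended complex-linearly, kills V = -aX₂ + c((1 +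
t²)a - b)X₁. By the Reeb property, F^*dθ(u, ∂_{z₁}) = da(u) and F^*dθ(u, ∂_{z₂}) = db(u) for u in ξ,
so Va = Vb = 0. Differentiating G = 0 along V leaves only the derivative of t, namely 2tc a²b = 0.
This fails wherever t ≠ 0, and such points are dense (`not_ker_pullback_holomorphic`). -/

theorem dCoord_apply (i : Fin 6) (v : R6) : dCoord i v = v i := rfl

theorem betaOne_apply (p v : R6) : betaOne p v = v 4 - p 2 * v 0
    - 2 * p 3 / (Real.pi * (1 + p 1 ^ 2)) * v 1
    - (8 / (3 * Real.pi ^ 3) * Real.arctan (p 1) ^ 3 + 2 / Real.pi * Real.arctan (p 1) + 2 * p 0)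
      * v 2 := by
  simp [betaOne, dCoord_apply]

theorem betaTwo_apply (p v : R6) : betaTwo p v = v 5 - p 3 * v 0
    - 2 * p 2 / (Real.pi * (1 + p 1 ^ 2)) * v 1 := by
  simp [betaTwo, dCoord_apply]

/-! ### The coordinate t and the exterior derivatives of the two forms -/

/-- The coordinate `t = (2 / π) arctan x₂`, with values in `(-1, 1)`. -/
def tCoord (p : R6) : ℝ := 2 / Real.pi * Real.arctan (p 1)

/-- The factor `∂t / ∂x₂`. -/
def tDeriv (p : R6) : ℝ := 2 / (Real.pi * (1 + p 1 ^ 2))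

theorem tDeriv_pos (p : R6) : 0 < tDeriv p := by
  unfold tDeriv
  have := Real.pi_pos
  positivity

theorem tCoord_sq_lt_one (p : R6) : tCoord p ^ 2 < 1 := by
  have hp := Real.pi_pos
  have h1 := Real.arctan_lt_pi_div_two (p 1)
  have h2 := Real.neg_pi_div_two_lt_arctan (p 1)
  have e : tCoord p = Real.arctan (p 1) / (Real.pi / 2) := by
    unfold tCoord; field_simp
  rw [sq_lt_one_iff_abs_lt_one, e, abs_lt]
  constructor
  · rw [lt_div_iff₀ (by positivity)]; linarith
  · rw [div_lt_iff₀ (by positivity)]; linarith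

theorem tCoord_ne_zero {p : R6} (hp : p 1 ≠ 0) : tCoord p ≠ 0 := by
  unfold tCoord
  have := Real.pi_pos.ne'
  simp [this, hp, Real.arctan_eq_zero_iff]

theorem hasFDerivAt_coord (i : Fin 6) (p : R6) : HasFDerivAt (fun y : R6 => y i) (dCoord i) p :=
  (dCoord i).hasFDerivAt

theorem hasFDerivAt_tCoord (p : R6) : HasFDerivAt tCoord (tDeriv p • dCoord 1) p := by
  have h := ((hasFDerivAt_coord 1 p).arctan).const_mul (2 / Real.pi)
  refine h.congr_fderiv ?_
  rw [smul_smul]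
  congr 1
  unfold tDeriv
  field_simp

theorem contDiff_coord (i : Fin 6) : ContDiff ℝ ∞ (fun y : R6 => y i) := (dCoord i).contDiff

theorem contDiff_tDeriv : ContDiff ℝ ∞ tDeriv := by
  unfold tDeriv
  refine contDiff_const.div (contDiff_const.mul (contDiff_const.add ((contDiff_coord 1).pow 2))) ?_
  intro p
  have := Real.pi_pos
  positivity

theorem contDiff_tCoord : ContDiff ℝ ∞ tCoord :=
  contDiff_const.mul ((contDiff_coord 1).arctan)

theorem betaOne_eq (p : R6) : betaOne p = dCoord 4 - p 2 • dCoord 0 - (p 3 * tDeriv p) • dCoord 1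
    - (tCoord p ^ 3 / 3 + tCoord p + 2 * p 0) • dCoord 2 := by
  have h1 : 2 * p 3 / (Real.pi * (1 + p 1 ^ 2)) = p 3 * tDeriv p := by
    unfold tDeriv; ring
  have h2 : 8 / (3 * Real.pi ^ 3) * Real.arctan (p 1) ^ 3 = tCoord p ^ 3 / 3 := by
    unfold tCoord; field_simp; ring
  rw [betaOne, h1, h2]; rfl

theorem betaTwo_eq (p : R6) : betaTwo p = dCoord 5 - p 3 • dCoord 0
    - (p 2 * tDeriv p) • dCoord 1 := by
  have h1 : 2 * p 2 / (Real.pi * (1 + p 1 ^ 2)) = p 2 * tDeriv p := by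
    unfold tDeriv; ring
  rw [betaTwo, h1]

theorem contDiff_betaOne : ContDiff ℝ ∞ betaOne := by
  rw [show betaOne = _ from funext betaOne_eq]
  have := contDiff_tDeriv
  have := contDiff_tCoord
  have := contDiff_coord
  fun_prop

theorem contDiff_betaTwo : ContDiff ℝ ∞ betaTwo := by
  rw [show betaTwo = _ from funext betaTwo_eq]
  have := contDiff_tDeriv
  have := contDiff_coord
  fun_prop

/-- The exterior derivative of `betaOne`. -/
def dBetaOne (p u v : R6) : ℝ := -(u 0 * v 2 - u 2 * v 0) + tDeriv p * (u 1 * v 3 - u 3 * v 1)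
  - (1 + tCoord p ^ 2) * tDeriv p * (u 1 * v 2 - u 2 * v 1)

/-- The exterior derivative of `betaTwo`. -/
def dBetaTwo (p u v : R6) : ℝ := (u 0 * v 3 - u 3 * v 0) + tDeriv p * (u 1 * v 2 - u 2 * v 1)

/-- Only proportionality to dx₂ matters: the factor multiplies dx₂ in both forms, so its derivative
enters through dx₂ ∧ dx₂ = 0 and `k` cancels. -/
theorem exists_hasFDerivAt_tDeriv (p : R6) : ∃ k : ℝ, HasFDerivAt tDeriv (k • dCoord 1) p := by
  have h : DifferentiableAt ℝ (fun s : ℝ => 2 / (Real.pi * (1 + s ^ 2))) (p 1) := by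
    have := Real.pi_pos
    refine DifferentiableAt.div (by fun_prop) (by fun_prop) (by positivity)
  have h' := HasDerivAt.comp_hasFDerivAt (f := fun y : R6 => y 1) p h.hasDerivAt
    (hasFDerivAt_coord 1 p)
  exact ⟨_, h'⟩

theorem fderiv_betaOne_antisymm (p u v : R6) :
    fderiv ℝ betaOne p u v - fderiv ℝ betaOne p v u = dBetaOne p u v := by
  obtain ⟨k, hd⟩ := exists_hasFDerivAt_tDeriv p
  have ht := hasFDerivAt_tCoord p
  have h := ((((hasFDerivAt_const (dCoord 4) p).sub
    ((hasFDerivAt_coord 2 p).smul_const (dCoord 0))).sub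
    (((hasFDerivAt_coord 3 p).mul hd).smul_const (dCoord 1))).sub
    ((((ht.pow 3).mul_const (1 / 3)).add ht |>.add
      ((hasFDerivAt_coord 0 p).const_mul 2)).smul_const (dCoord 2)))
  have h' := h.congr_of_eventuallyEq (f₁ := betaOne) (Filter.Eventually.of_forall fun y => by
    rw [betaOne_eq]; simp [div_eq_mul_inv])
  rw [h'.fderiv]
  simp [dCoord_apply, dBetaOne]
  ring

theorem fderiv_betaTwo_antisymm (p u v : R6) :
    fderiv ℝ betaTwo p u v - fderiv ℝ betaTwo p v u = dBetaTwo p u v := by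
  obtain ⟨k, hd⟩ := exists_hasFDerivAt_tDeriv p
  have h := (((hasFDerivAt_const (dCoord 5) p).sub
    ((hasFDerivAt_coord 3 p).smul_const (dCoord 0))).sub
    (((hasFDerivAt_coord 2 p).mul hd).smul_const (dCoord 1)))
  have h' := h.congr_of_eventuallyEq (f₁ := betaTwo) (Filter.Eventually.of_forall fun y => by
    rw [betaTwo_eq]; simp)
  rw [h'.fderiv]
  simp [dCoord_apply, dBetaTwo]
  ring

/-! ### Corank two and Reeb directions -/

theorem mem_xi {p v : R6} : v ∈ xi p ↔ betaOne p v = 0 ∧ betaTwo p v = 0 := Iff.rfl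

theorem contDiff_beta (i : Fin 2) : ContDiff ℝ ∞ ((![betaOne, betaTwo] : Fin 2 → _) i) := by
  fin_cases i
  · exact contDiff_betaOne
  · exact contDiff_betaTwo

theorem beta_coordField (p : R6) (i j : Fin 2) :
    (![betaOne, betaTwo] : Fin 2 → _) i p
      ((![coordField 4, coordField 5] : Fin 2 → _) j p) = if i = j then 1 else 0 := by
  fin_cases i <;> fin_cases j <;> simp [betaOne_apply, betaTwo_apply, coordField]

theorem isKernelOn_xi (U : Set R6) : IsKernelOn xi ![betaOne, betaTwo] U := fun _ _ => rfl

theorem extDerivOne_beta (p u v : R6) (i : Fin 2) :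
    extDerivOne ((![betaOne, betaTwo] : Fin 2 → _) i) p u v
      = (![dBetaOne, dBetaTwo] : Fin 2 → _) i p u v := by
  rw [extDerivOne_apply ((contDiff_beta i).differentiable (by simp) p)]
  fin_cases i
  · exact fderiv_betaOne_antisymm p u v
  · exact fderiv_betaTwo_antisymm p u v

/-- The ∂_z are dual to the forms β. This splitting gives the complement of ξ, a spanning pair for
the quotient, and later the expansion F^*θ = aβ₁ + bβ₂. -/
theorem sub_vertical_mem_xi (p v : R6) :
    v - (betaOne p v • coordField 4 p + betaTwo p v • coordField 5 p) ∈ xi p := by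
  rw [mem_xi]
  constructor
  · simp [betaOne_apply, coordField]; ring
  · simp [betaTwo_apply, coordField]; ring

theorem hasReebDirections_xi (q : R6) :
    HasReebDirections xi ![coordField 4, coordField 5] q := by
  refine ⟨Set.univ, isOpen_univ, trivial, fun i => ?_, ![betaOne, betaTwo],
    fun i => (contDiff_beta i).contDiffOn, isKernelOn_xi _, fun x _ => ⟨?_, beta_coordField x, ?_, ?_⟩⟩
  · fin_cases i <;> exact contDiffOn_const
  · have hs : (Submodule.span ℝ (Set.range fun i : Fin 2 =>
        (![coordField 4, coordField 5] : Fin 2 → R6 → R6) i x))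
        = Submodule.span ℝ {coordField 4 x, coordField 5 x} := by
      congr 1
      ext v
      simp [or_comm]
    rw [hs]
    constructor
    · rw [Submodule.disjoint_def]
      intro v hv hv'
      obtain ⟨a, b, rfl⟩ := Submodule.mem_span_pair.1 hv'
      rw [mem_xi] at hv
      have ha : a = 0 := by simpa [betaOne_apply, coordField] using hv.1
      have hb : b = 0 := by simpa [betaTwo_apply, coordField] using hv.2
      simp [ha, hb]
    · rw [codisjoint_iff, eq_top_iff]
      intro v _
      rw [← sub_add_cancel v (betaOne x v • coordField 4 x + betaTwo x v • coordField 5 x)]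
      exact Submodule.add_mem_sup (sub_vertical_mem_xi x v)
        (Submodule.mem_span_pair.2 ⟨_, _, rfl⟩)
  · intro i j v _
    rw [extDerivOne_beta]
    fin_cases i <;> fin_cases j <;> simp [dBetaOne, dBetaTwo, coordField]
  · have h : ∀ k, fderiv ℝ (coordField k) x = 0 := fun k => fderiv_const_apply _
    simp [VectorField.lieBracket, h]

theorem isCorankTwoGerm_xi (q : R6) : IsCorankTwoGerm xi q := by
  refine ⟨Set.univ, isOpen_univ, trivial, ![betaOne, betaTwo],
    fun i => (contDiff_beta i).contDiffOn, fun x _ => ?_, isKernelOn_xi _⟩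
  have e : (fun i : Fin 2 => (![betaOne, betaTwo] : Fin 2 → _) i x) = ![betaOne x, betaTwo x] := by
    ext i : 1
    fin_cases i <;> rfl
  rw [e, LinearIndependent.pair_iff]
  intro s t h
  constructor
  · simpa [betaOne_apply, betaTwo_apply, coordField] using DFunLike.congr_fun h (coordField 4 x)
  · simpa [betaOne_apply, betaTwo_apply, coordField] using DFunLike.congr_fun h (coordField 5 x)

/-! ### Curvature and fatness -/

/-- The curvature of `xi`. -/
def xiCurvature (p : R6) : xi p →ₗ[ℝ] xi p →ₗ[ℝ] (R6 ⧸ xi p) :=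
  -- The sign is that of Cartan's formula: β([u, v]) = -dβ(u, v) for sections u, v of ξ.
  LinearMap.mk₂ ℝ (fun a b => -(dBetaOne p a b • Submodule.Quotient.mk (coordField 4 p)
      + dBetaTwo p a b • Submodule.Quotient.mk (coordField 5 p)))
    (fun a a' b => by simp only [dBetaOne, dBetaTwo, Submodule.coe_add, PiLp.add_apply]; module)
    (fun c a b => by
      simp only [dBetaOne, dBetaTwo, Submodule.coe_smul, PiLp.smul_apply, smul_eq_mul]; module)
    (fun a b b' => by simp only [dBetaOne, dBetaTwo, Submodule.coe_add, PiLp.add_apply]; module)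
    (fun c a b => by
      simp only [dBetaOne, dBetaTwo, Submodule.coe_smul, PiLp.smul_apply, smul_eq_mul]; module)

theorem xiCurvature_apply (p : R6) (a b : xi p) :
    xiCurvature p a b = -(dBetaOne p a b • Submodule.Quotient.mk (coordField 4 p)
      + dBetaTwo p a b • Submodule.Quotient.mk (coordField 5 p)) := rfl

/-- The Cartan formula for two vector fields annihilated by a one-form. -/
theorem apply_lieBracket_of_eventually_eq_zero {E : Type*} [NormedAddCommGroup E] [NormedSpace ℝ E]
    {θ : E → E →L[ℝ] ℝ} {u v : E → E} {q : E} (hθ : DifferentiableAt ℝ θ q)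
    (hu : DifferentiableAt ℝ u q) (hv : DifferentiableAt ℝ v q)
    (hu' : ∀ᶠ x in 𝓝 q, θ x (u x) = 0) (hv' : ∀ᶠ x in 𝓝 q, θ x (v x) = 0) :
    θ q (VectorField.lieBracket ℝ u v q)
      = -(fderiv ℝ θ q (u q) (v q) - fderiv ℝ θ q (v q) (u q)) := by
  have key : ∀ {w : E → E}, DifferentiableAt ℝ w q → (∀ᶠ x in 𝓝 q, θ x (w x) = 0) →
      ∀ z : E, θ q (fderiv ℝ w q z) + fderiv ℝ θ q z (w q) = 0 := by
    intro w hw hw' z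
    have h1 := hθ.hasFDerivAt.clm_apply hw.hasFDerivAt
    have h2 : HasFDerivAt (fun x => θ x (w x)) (0 : E →L[ℝ] ℝ) q :=
      (hasFDerivAt_const (0 : ℝ) q).congr_of_eventuallyEq hw'
    simpa using DFunLike.congr_fun (h1.unique h2) z
  have e1 := key hu hu' (v q)
  have e2 := key hv hv' (u q)
  rw [VectorField.lieBracket, map_sub]
  linarith

theorem isCurvatureAt_xi (q : R6) : IsCurvatureAt xi q (xiCurvature q) := by
  rintro u v ⟨U, hU, hqU, hu, hu'⟩ ⟨V, hV, hqV, hv, hv'⟩ a b ha hb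
  have du := (hu.contDiffAt (hU.mem_nhds hqU)).differentiableAt (by simp)
  have dv := (hv.contDiffAt (hV.mem_nhds hqV)).differentiableAt (by simp)
  have hu'' : ∀ᶠ x in 𝓝 q, u x ∈ xi x := Filter.mem_of_superset (hU.mem_nhds hqU) hu'
  have hv'' : ∀ᶠ x in 𝓝 q, v x ∈ xi x := Filter.mem_of_superset (hV.mem_nhds hqV) hv'
  have h1 := apply_lieBracket_of_eventually_eq_zero
    (contDiff_betaOne.differentiable (by simp) q) du dv (hu''.mono fun x h => h.1)
    (hv''.mono fun x h => h.1)
  have h2 := apply_lieBracket_of_eventually_eq_zero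
    (contDiff_betaTwo.differentiable (by simp) q) du dv (hu''.mono fun x h => h.2)
    (hv''.mono fun x h => h.2)
  rw [fderiv_betaOne_antisymm, ha, hb] at h1
  rw [fderiv_betaTwo_antisymm, ha, hb] at h2
  have h3 := (Submodule.Quotient.eq (xi q)).2
    (sub_vertical_mem_xi q (VectorField.lieBracket ℝ u v q))
  rw [h3, h1, h2, xiCurvature_apply, Submodule.Quotient.mk_add, Submodule.Quotient.mk_smul,
    Submodule.Quotient.mk_smul]
  module

theorem eq_zero_of_mem_xi {p v : R6} (hv : v ∈ xi p) (h : ∀ j : Fin 4, v (j.castLE (by omega)) = 0) :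
    v = 0 := by
  have h0 : v 0 = 0 := h 0
  have h1 : v 1 = 0 := h 1
  have h2 : v 2 = 0 := h 2
  have h3 : v 3 = 0 := h 3
  obtain ⟨e1, e2⟩ := mem_xi.1 hv
  rw [betaOne_apply] at e1
  rw [betaTwo_apply] at e2
  simp only [h0, h1, h2, mul_zero, sub_zero] at e1 e2
  ext j
  fin_cases j <;> simp [*]

/-- The horizontal coordinates of four vectors of `xi p`. -/
def horizontalMatrix {p : R6} (e : Fin 4 → xi p) : Matrix (Fin 4) (Fin 4) ℝ :=
  Matrix.of fun i j => (e i : R6) (j.castLE (by omega))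

theorem det_horizontalMatrix_ne_zero {p : R6} (e : Module.Basis (Fin 4) ℝ (xi p)) :
    (horizontalMatrix e).det ≠ 0 := by
  intro h
  obtain ⟨v, hv, hv'⟩ := Matrix.exists_vecMul_eq_zero_iff.2 h
  have h0 : ∑ i, v i • e i = 0 := by
    apply Subtype.ext
    refine eq_zero_of_mem_xi (Submodule.coe_mem _) fun j => ?_
    have := congrFun hv' j
    simpa [Matrix.vecMul, dotProduct, horizontalMatrix] using this
  exact hv (funext fun i => (Fintype.linearIndependent_iff.1 e.linearIndependent) v h0 i)

theorem curvatureForm_xi (p : R6) (e : Module.Basis (Fin 4) ℝ (xi p))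
    (ψ : Module.Dual ℝ (R6 ⧸ xi p)) :
    curvatureForm (xiCurvature p) e ψ ψ = (2 * tDeriv p * (horizontalMatrix e).det) *
      (ψ (Submodule.Quotient.mk (coordField 4 p)) ^ 2
        + ψ (Submodule.Quotient.mk (coordField 5 p)) ^ 2
        - (1 + tCoord p ^ 2) * ψ (Submodule.Quotient.mk (coordField 4 p))
          * ψ (Submodule.Quotient.mk (coordField 5 p))) := by
  -- Laplace expansion along the first two rows: its products of complementary 2×2 minors are those
  -- occurring in `wedgeTwoTwo`.
  have hd : ∀ A : Matrix (Fin 4) (Fin 4) ℝ, A.det =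
      (A 0 0 * A 1 1 - A 0 1 * A 1 0) * (A 2 2 * A 3 3 - A 2 3 * A 3 2)
      - (A 0 0 * A 1 2 - A 0 2 * A 1 0) * (A 2 1 * A 3 3 - A 2 3 * A 3 1)
      + (A 0 0 * A 1 3 - A 0 3 * A 1 0) * (A 2 1 * A 3 2 - A 2 2 * A 3 1)
      + (A 0 1 * A 1 2 - A 0 2 * A 1 1) * (A 2 0 * A 3 3 - A 2 3 * A 3 0)
      - (A 0 1 * A 1 3 - A 0 3 * A 1 1) * (A 2 0 * A 3 2 - A 2 2 * A 3 0)
      + (A 0 2 * A 1 3 - A 0 3 * A 1 2) * (A 2 0 * A 3 1 - A 2 1 * A 3 0) := by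
    intro A
    rw [Matrix.det_succ_row_zero]
    simp [Fin.sum_univ_succ, Matrix.det_fin_three, Fin.succAbove]
    ring
  have hL : ∀ a b : xi p, ψ (xiCurvature p a b)
      = -(dBetaOne p a b * ψ (Submodule.Quotient.mk (coordField 4 p))
        + dBetaTwo p a b * ψ (Submodule.Quotient.mk (coordField 5 p))) := by
    intro a b
    rw [xiCurvature_apply, map_neg, map_add, map_smul, map_smul, smul_eq_mul, smul_eq_mul]
  have hM : ∀ i, (e i : R6) 0 = horizontalMatrix e i 0 ∧ (e i : R6) 1 = horizontalMatrix e i 1 ∧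
      (e i : R6) 2 = horizontalMatrix e i 2 ∧ (e i : R6) 3 = horizontalMatrix e i 3 :=
    fun i => ⟨rfl, rfl, rfl, rfl⟩
  rw [hd]
  simp only [curvatureForm, wedgeTwoTwo, hL, dBetaOne, dBetaTwo, fun i => (hM i).1,
    fun i => (hM i).2.1, fun i => (hM i).2.2.1, fun i => (hM i).2.2.2]
  generalize horizontalMatrix e = A
  ring

theorem isEllipticAt_xi (p : R6) : IsEllipticAt xi p := by
  refine ⟨xiCurvature p, isCurvatureAt_xi p, fun e => ?_⟩
  have hpos : ∀ ψ : Module.Dual ℝ (R6 ⧸ xi p), ψ ≠ 0 →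
      0 < ψ (Submodule.Quotient.mk (coordField 4 p)) ^ 2
        + ψ (Submodule.Quotient.mk (coordField 5 p)) ^ 2
        - (1 + tCoord p ^ 2) * ψ (Submodule.Quotient.mk (coordField 4 p))
          * ψ (Submodule.Quotient.mk (coordField 5 p)) := by
    intro ψ hψ
    have ht := tCoord_sq_lt_one p
    have ht0 := sq_nonneg (tCoord p)
    set a := ψ (Submodule.Quotient.mk (coordField 4 p)) with ha
    set b := ψ (Submodule.Quotient.mk (coordField 5 p)) with hb
    have hab : 0 < a ^ 2 + b ^ 2 := by
      by_contra hcon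
      have ha0 : a = 0 := by nlinarith [sq_nonneg a, sq_nonneg b]
      have hb0 : b = 0 := by nlinarith [sq_nonneg a, sq_nonneg b]
      refine hψ (LinearMap.ext fun w => ?_)
      obtain ⟨w, rfl⟩ := Submodule.Quotient.mk_surjective _ w
      rw [(Submodule.Quotient.eq (xi p)).2 (sub_vertical_mem_xi p w), Submodule.Quotient.mk_add,
        Submodule.Quotient.mk_smul, Submodule.Quotient.mk_smul, map_add, map_smul, map_smul,
        ← ha, ← hb, ha0, hb0]
      simp
    -- 2(a² + b² - (1 + t²)ab) = (1 + t²)(a - b)² + (1 - t²)(a² + b²).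
    nlinarith [mul_nonneg ht0 (sq_nonneg (a - b)), mul_nonneg ht0 (sq_nonneg (a + b)),
      mul_pos (sub_pos.2 ht) hab, sq_nonneg (a - b)]
  have hc := tDeriv_pos p
  rcases lt_or_gt_of_ne (det_horizontalMatrix_ne_zero e) with hdet | hdet
  · refine Or.inr fun ψ hψ => ?_
    rw [curvatureForm_xi]
    exact mul_neg_of_neg_of_pos (mul_neg_of_pos_of_neg (by positivity) hdet) (hpos ψ hψ)
  · refine Or.inl fun ψ hψ => ?_
    rw [curvatureForm_xi]
    exact mul_pos (mul_pos (by positivity) hdet) (hpos ψ hψ)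

theorem isFatGerm_xi (q : R6) : IsFatGerm xi q :=
  ⟨isCorankTwoGerm_xi q, Filter.Eventually.of_forall isEllipticAt_xi⟩

/-! ### The obstruction from a holomorphic one-form -/

/-- Three vectors in a complex plane satisfy the relation `∑ B(uᵢ, uⱼ) uₖ = 0` for every alternating
form `B`. -/
theorem cyclic_relation_of_mem_ker {l : C3 →L[ℂ] ℂ} (hl : l ≠ 0) (B : C3 → C3 →L[ℂ] ℂ)
    (hB : ∀ u v, B u v = -B v u) {u₁ u₂ u₃ : C3} (h₁ : l u₁ = 0) (h₂ : l u₂ = 0) (h₃ : l u₃ = 0)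
    (w : C3) : B u₁ u₂ * B u₃ w + B u₂ u₃ * B u₁ w + B u₃ u₁ * B u₂ w = 0 := by
  have hker : Module.finrank ℂ l.ker = 2 := by
    have h1 := LinearMap.finrank_range_add_finrank_ker l.toLinearMap
    have h2 : Module.finrank ℂ (LinearMap.range l.toLinearMap) = 1 := by
      rw [LinearMap.range_eq_top.2 (LinearMap.surjective (f := l.toLinearMap)
        (fun h => hl (ContinuousLinearMap.coe_injective h)))]
      simp
    have h3 : Module.finrank ℂ C3 = 3 := by simp
    rw [h2, h3] at h1
    change Module.finrank ℂ (LinearMap.ker l.toLinearMap) = 2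
    omega
  -- A dependence ∑ cᵢuᵢ = 0 is paired through `B` with each uⱼ and with `w`. Some cᵢ ≠ 0, and cᵢ
  -- times the cyclic sum is a combination of these equations.
  have hdep : ¬ LinearIndependent ℂ (![⟨u₁, h₁⟩, ⟨u₂, h₂⟩, ⟨u₃, h₃⟩] : Fin 3 → l.ker) := by
    intro h
    have := h.fintype_card_le_finrank
    simp [hker] at this
  obtain ⟨c, hc, i, hi⟩ := Fintype.not_linearIndependent_iff.1 hdep
  have hc' : c 0 • u₁ + c 1 • u₂ + c 2 • u₃ = 0 := by
    simpa [Fin.sum_univ_three] using congrArg Subtype.val hc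
  have e : ∀ z, c 0 * B z u₁ + c 1 * B z u₂ + c 2 * B z u₃ = 0 := fun z => by
    simpa using congrArg (B z) hc'
  have a12 := hB u₁ u₂
  have a13 := hB u₃ u₁
  have a23 := hB u₂ u₃
  have a11 : B u₁ u₁ = 0 := by have := hB u₁ u₁; linear_combination this / 2
  have a22 : B u₂ u₂ = 0 := by have := hB u₂ u₂; linear_combination this / 2
  have a33 : B u₃ u₃ = 0 := by have := hB u₃ u₃; linear_combination this / 2
  have e1 := e u₁
  have e2 := e u₂
  have e3 := e u₃
  have ew := e w
  rw [hB w u₁, hB w u₂, hB w u₃] at ew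
  rw [a11] at e1
  rw [a22] at e2
  rw [a33] at e3
  generalize B u₁ w = w1 at *
  generalize B u₂ w = w2 at *
  generalize B u₃ w = w3 at *
  generalize B u₂ u₁ = p at *
  generalize B u₃ u₁ = r at *
  generalize B u₁ u₃ = r' at *
  generalize B u₂ u₃ = q at *
  generalize B u₃ u₂ = q' at *
  generalize B u₁ u₂ = p' at *
  subst a12 a13 a23
  fin_cases i
  · refine (mul_eq_zero.1 (?_ : c 0 * _ = 0)).resolve_left hi
    linear_combination -w3 * e2 + q' * ew + w2 * e3
  · refine (mul_eq_zero.1 (?_ : c 1 * _ = 0)).resolve_left hi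
    linear_combination w3 * e1 + r' * ew - w1 * e3
  · refine (mul_eq_zero.1 (?_ : c 2 * _ = 0)).resolve_left hi
    linear_combination -w2 * e1 + p * ew + w1 * e2

/-- The antisymmetrised derivative of a one-form. -/
def dForm (θ : C3 → C3 →L[ℂ] ℂ) (y : C3) (u : C3) : C3 →L[ℂ] ℂ :=
  fderiv ℂ θ y u - (fderiv ℂ θ y).flip u

theorem dForm_antisymm (θ : C3 → C3 →L[ℂ] ℂ) (y u v : C3) : dForm θ y u v = -dForm θ y v u := by
  simp [dForm]

/-- The chain rule with `v` frozen. The second-derivative term is symmetric in `u` and `v`, so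
antisymmetrising gives d(F^*θ) = F^*dθ. -/
theorem hasFDerivAt_pullback {F : R6 → C3} {θ : C3 → C3 →L[ℂ] ℂ} {x : R6}
    (hF : ContDiffAt ℝ 2 F x) (hθ : DifferentiableAt ℂ θ (F x)) (v : R6) :
    ∃ l : R6 →L[ℝ] ℂ, HasFDerivAt (fun y => θ (F y) (fderiv ℝ F y v)) l x ∧
      ∀ u, l u = fderiv ℂ θ (F x) (fderiv ℝ F x u) (fderiv ℝ F x v)
        + θ (F x) (fderiv ℝ (fderiv ℝ F) x u v) := by
  have h1 : HasFDerivAt (fun y => (θ (F y)).restrictScalars ℝ)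
      ((ContinuousLinearMap.restrictScalarsL ℂ C3 ℂ ℝ ℝ).comp
        (((fderiv ℂ θ (F x)).restrictScalars ℝ).comp (fderiv ℝ F x))) x :=
    (ContinuousLinearMap.restrictScalarsL ℂ C3 ℂ ℝ ℝ).hasFDerivAt.comp x
      ((hθ.hasFDerivAt.restrictScalars ℝ).comp x (hF.differentiableAt (by simp)).hasFDerivAt)
  have h2 : HasFDerivAt (fderiv ℝ F) (fderiv ℝ (fderiv ℝ F) x) x :=
    ((hF.fderiv_right (m := 1) (by norm_num)).differentiableAt (by simp)).hasFDerivAt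
  have h3 := h1.clm_apply (h2.clm_apply (hasFDerivAt_const v x))
  refine ⟨_, h3, fun u => ?_⟩
  simp [add_comm]

theorem exists_mem_ne_zero {U : Set R6} (hU : IsOpen U) {q : R6} (hq : q ∈ U) :
    ∃ p ∈ U, p 1 ≠ 0 := by
  by_cases h : q 1 = 0
  · have hc : Continuous fun s : ℝ => q + s • coordField 1 q := by fun_prop
    have h1 : ∀ᶠ s in 𝓝[≠] (0 : ℝ), q + s • coordField 1 q ∈ U :=
      (hc.tendsto' 0 q (by simp)).eventually (hU.mem_nhds hq) |>.filter_mono nhdsWithin_le_nhds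
    obtain ⟨s, hs, hs'⟩ := (h1.and self_mem_nhdsWithin).exists
    exact ⟨_, hs, by simpa [h, coordField] using hs'⟩
  · exact ⟨q, hq, h⟩

/-- No open piece of `xi` is cut out by the pullback of a holomorphic one-form. -/
theorem not_ker_pullback_holomorphic {U : Set R6} (hU : IsOpen U) (hne : U.Nonempty)
    {F : R6 → C3} (hF : ContDiffOn ℝ ∞ F U) {V : Set C3} (hV : IsOpen V)
    {θ : C3 → C3 →L[ℂ] ℂ} (hθ : DifferentiableOn ℂ θ V) (hFV : Set.MapsTo F U V)
    (hker : ∀ x ∈ U, ∀ v : R6, v ∈ xi x ↔ θ (F x) (fderiv ℝ F x v) = 0) : False := by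
  obtain ⟨q, hq⟩ := hne
  obtain ⟨p, hp, hp1⟩ := exists_mem_ne_zero hU hq
  have ht0 := tCoord_ne_zero hp1
  have hc0 := (tDeriv_pos p).ne'
  have hF2 : ∀ x ∈ U, ContDiffAt ℝ 2 F x := fun x hx =>
    (hF.contDiffAt (hU.mem_nhds hx)).of_le ENat.LEInfty.out
  have hθ' : ∀ x ∈ U, DifferentiableAt ℂ θ (F x) := fun x hx =>
    (hθ _ (hFV hx)).differentiableAt (hV.mem_nhds (hFV hx))
  set a : R6 → ℂ := fun y => θ (F y) (fderiv ℝ F y (coordField 4 p))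
  set b : R6 → ℂ := fun y => θ (F y) (fderiv ℝ F y (coordField 5 p))
  have ha0 : ∀ x ∈ U, a x ≠ 0 := fun x hx h => by
    have := ((hker x hx _).2 h).1
    simp [betaOne_apply, coordField] at this
  have hb0 : ∀ x ∈ U, b x ≠ 0 := fun x hx h => by
    have := ((hker x hx _).2 h).2
    simp [betaTwo_apply, coordField] at this
  have hdec : ∀ v : R6, ∀ x ∈ U, θ (F x) (fderiv ℝ F x v)
      = (betaOne x v : ℂ) * a x + (betaTwo x v : ℂ) * b x := by
    intro v x hx
    have h := (hker x hx _).1 (sub_vertical_mem_xi x v)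
    simp only [map_sub, map_add, map_smul, ContinuousLinearMap.map_smul_of_tower,
      Complex.real_smul] at h
    exact sub_eq_zero.1 h
  have hda : ∀ x ∈ U, DifferentiableAt ℝ a x := fun x hx =>
    (hasFDerivAt_pullback (hF2 x hx) (hθ' x hx) _).choose_spec.1.differentiableAt
  have hdb : ∀ x ∈ U, DifferentiableAt ℝ b x := fun x hx =>
    (hasFDerivAt_pullback (hF2 x hx) (hθ' x hx) _).choose_spec.1.differentiableAt
  -- F^*dθ = da ∧ β₁ + a dβ₁ + db ∧ β₂ + b dβ₂.
  have hd : ∀ x ∈ U, ∀ u v : R6, dForm θ (F x) (fderiv ℝ F x u) (fderiv ℝ F x v)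
      = fderiv ℝ a x u * betaOne x v - fderiv ℝ a x v * betaOne x u + dBetaOne x u v * a x
        + (fderiv ℝ b x u * betaTwo x v - fderiv ℝ b x v * betaTwo x u + dBetaTwo x u v * b x) := by
    intro x hx
    have key : ∀ u v : R6, fderiv ℂ θ (F x) (fderiv ℝ F x u) (fderiv ℝ F x v)
        + θ (F x) (fderiv ℝ (fderiv ℝ F) x u v)
        = fderiv ℝ a x u * betaOne x v + fderiv ℝ betaOne x u v * a x
          + (fderiv ℝ b x u * betaTwo x v + fderiv ℝ betaTwo x u v * b x) := by
      intro u v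
      obtain ⟨l, hl, hl'⟩ := hasFDerivAt_pullback (hF2 x hx) (hθ' x hx) v
      have e1 : HasFDerivAt (fun y => betaOne y v • a y + betaTwo y v • b y) _ x :=
        (((((contDiff_betaOne.differentiable (by simp) x).hasFDerivAt).clm_apply
          (hasFDerivAt_const v x)).smul (hda x hx).hasFDerivAt)).add
        (((((contDiff_betaTwo.differentiable (by simp) x).hasFDerivAt).clm_apply
          (hasFDerivAt_const v x)).smul (hdb x hx).hasFDerivAt))
      have e2 := e1.congr_of_eventuallyEq (f₁ := fun y => θ (F y) (fderiv ℝ F y v))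
        (Filter.mem_of_superset (hU.mem_nhds hx) fun y hy => by
          simpa [Complex.real_smul] using hdec v y hy)
      rw [← hl', hl.unique e2]
      simp
      ring
    intro u v
    have hs := (hF2 x hx).isSymmSndFDerivAt (by simp) u v
    have e1 := key u v
    have e2 := key v u
    rw [hs] at e1
    have e3 := fderiv_betaOne_antisymm x u v
    have e4 := fderiv_betaTwo_antisymm x u v
    rw [← e3, ← e4]
    simp only [dForm, sub_apply, ContinuousLinearMap.flip_apply]
    push_cast
    linear_combination e1 - e2
  -- the horizontal frame
  let X1 : R6 → R6 := fun x => !₂[1, 0, 0, 0, x 2, x 3]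
  let X2 : R6 → R6 := fun x => !₂[0, 1, 0, 0, x 3 * tDeriv x, x 2 * tDeriv x]
  let Y1 : R6 → R6 := fun x => !₂[0, 0, 1, 0, tCoord x ^ 3 / 3 + tCoord x + 2 * x 0, 0]
  let Y2 : R6 → R6 := fun _ => !₂[0, 0, 0, 1, 0, 0]
  have hX1 : ∀ x, X1 x ∈ xi x := fun x => by
    rw [mem_xi, betaOne_eq, betaTwo_eq]; simp [X1, dCoord_apply]
  have hX2 : ∀ x, X2 x ∈ xi x := fun x => by
    rw [mem_xi, betaOne_eq, betaTwo_eq]; simp [X2, dCoord_apply]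
  have hY1 : ∀ x, Y1 x ∈ xi x := fun x => by
    rw [mem_xi, betaOne_eq, betaTwo_eq]; simp [Y1, dCoord_apply]
  have hY2 : ∀ x, Y2 x ∈ xi x := fun x => by
    rw [mem_xi, betaOne_eq, betaTwo_eq]; simp [Y2, dCoord_apply]
  have hxx : ∀ x ∈ U, ∀ u ∈ xi x, ∀ v ∈ xi x,
      dForm θ (F x) (fderiv ℝ F x u) (fderiv ℝ F x v)
        = dBetaOne x u v * a x + dBetaTwo x u v * b x := by
    intro x hx u hu v hv
    rw [hd x hx, (mem_xi.1 hu).1, (mem_xi.1 hu).2, (mem_xi.1 hv).1, (mem_xi.1 hv).2]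
    simp
  have hl0 : ∀ x ∈ U, θ (F x) ≠ 0 := fun x hx h => ha0 x hx (by simp [a, h])
  have hcyc := fun x hx {u v w : R6} (hu : u ∈ xi x) (hv : v ∈ xi x) (hw : w ∈ xi x) =>
    cyclic_relation_of_mem_ker (hl0 x hx) (dForm θ (F x)) (dForm_antisymm θ (F x))
      ((hker x hx u).1 hu) ((hker x hx v).1 hv) ((hker x hx w).1 hw)
  have hG : ∀ x ∈ U, a x ^ 2 + b x ^ 2 - (1 + (tCoord x : ℂ) ^ 2) * (a x * b x) = 0 := by
    intro x hx
    -- With Y₂ as fourth vector the cyclic sum is the Pfaffian of F^*dθ on the frame of ξ, equal to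
    -- -c times the quadratic expression.
    have h := hcyc x hx (hX1 x) (hY1 x) (hX2 x) (fderiv ℝ F x (Y2 x))
    simp only [hxx x hx _ (hX1 x) _ (hY1 x), hxx x hx _ (hX2 x) _ (hY2 x),
      hxx x hx _ (hY1 x) _ (hX2 x), hxx x hx _ (hX1 x) _ (hY2 x),
      hxx x hx _ (hX2 x) _ (hX1 x)] at h
    simp [dBetaOne, dBetaTwo, X1, X2, Y1, Y2] at h
    have hc : (tDeriv x : ℂ) ≠ 0 := by exact_mod_cast (tDeriv_pos x).ne'
    refine (mul_eq_zero.1 (?_ : (tDeriv x : ℂ) * _ = 0)).resolve_left hc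
    linear_combination -h
  have hv4 : ∀ x ∈ U, ∀ u ∈ xi x,
      dForm θ (F x) (fderiv ℝ F x u) (fderiv ℝ F x (coordField 4 p)) = fderiv ℝ a x u := by
    intro x hx u hu
    rw [hd x hx, (mem_xi.1 hu).1, (mem_xi.1 hu).2]
    simp [betaOne_apply, betaTwo_apply, dBetaOne, dBetaTwo, coordField]
  have hv5 : ∀ x ∈ U, ∀ u ∈ xi x,
      dForm θ (F x) (fderiv ℝ F x u) (fderiv ℝ F x (coordField 5 p)) = fderiv ℝ b x u := by
    intro x hx u hu
    rw [hd x hx, (mem_xi.1 hu).1, (mem_xi.1 hu).2]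
    simp [betaOne_apply, betaTwo_apply, dBetaOne, dBetaTwo, coordField]
  -- Paired with ∂_{z₁} and ∂_{z₂}, the cyclic sum becomes Va = 0 and Vb = 0; the Y₁ term drops out
  -- because X₁, X₂ pair to zero.
  have hA := hcyc p hp (hX1 p) (hY1 p) (hX2 p) (fderiv ℝ F p (coordField 4 p))
  have hB := hcyc p hp (hX1 p) (hY1 p) (hX2 p) (fderiv ℝ F p (coordField 5 p))
  simp only [hxx p hp _ (hX1 p) _ (hY1 p), hxx p hp _ (hY1 p) _ (hX2 p),
    hxx p hp _ (hX2 p) _ (hX1 p), hv4 p hp _ (hX1 p), hv4 p hp _ (hX2 p), hv4 p hp _ (hY1 p),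
    hv5 p hp _ (hX1 p), hv5 p hp _ (hX2 p), hv5 p hp _ (hY1 p)] at hA hB
  -- differentiate the quadratic relation
  have hdG : ∀ u : R6, 2 * a p * fderiv ℝ a p u + 2 * b p * fderiv ℝ b p u
      - (1 + (tCoord p : ℂ) ^ 2) * (a p * fderiv ℝ b p u + b p * fderiv ℝ a p u)
      - 2 * tCoord p * tDeriv p * u 1 * (a p * b p) = 0 := by
    intro u
    have dt := (Complex.ofRealCLM.hasFDerivAt (x := tCoord p)).comp p (hasFDerivAt_tCoord p)
    have da := (hda p hp).hasFDerivAt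
    have db := (hdb p hp).hasFDerivAt
    have h1 := ((da.pow 2).add (db.pow 2)).sub (((dt.pow 2).const_add 1).mul (da.mul db))
    have h2 : HasFDerivAt
        (fun y => a y ^ 2 + b y ^ 2 - (1 + (tCoord y : ℂ) ^ 2) * (a y * b y)) (0 : R6 →L[ℝ] ℂ) p :=
      (hasFDerivAt_const (0 : ℂ) p).congr_of_eventuallyEq
      (Filter.mem_of_superset (hU.mem_nhds hp) fun y hy => hG y hy)
    have h3 := DFunLike.congr_fun (h1.unique h2) u
    simp [dCoord_apply] at h3
    linear_combination h3
  have h1 := hdG (X1 p)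
  have h2 := hdG (X2 p)
  have h3 := hG p hp
  have e1 : X1 p 1 = 0 := by simp [X1]
  have e2 : X2 p 1 = 1 := by simp [X2]
  rw [e1] at h1
  rw [e2] at h2
  generalize fderiv ℝ a p (X1 p) = a1 at *
  generalize fderiv ℝ a p (X2 p) = a2 at *
  generalize fderiv ℝ b p (X1 p) = b1 at *
  generalize fderiv ℝ b p (X2 p) = b2 at *
  simp [dBetaOne, dBetaTwo, X1, X2, Y1] at hA hB
  -- The first two terms form dG(V); the multiples of `hA` and `hB` by ∂G/∂a and ∂G/∂b remove Va and
  -- Vb.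
  have hfin : (2 * tDeriv p * tCoord p : ℂ) * (a p ^ 2 * b p) = 0 := by
    push_cast at h1 h2
    linear_combination (-(a p)) * h2 + (tDeriv p : ℂ) * ((1 + (tCoord p : ℂ) ^ 2) * a p - b p) * h1
      - (2 * a p - (1 + (tCoord p : ℂ) ^ 2) * b p) * hA
      - (2 * b p - (1 + (tCoord p : ℂ) ^ 2) * a p) * hB
  have hc0' : (tDeriv p : ℂ) ≠ 0 := by exact_mod_cast hc0
  have ht0' : (tCoord p : ℂ) ≠ 0 := by exact_mod_cast ht0
  exact mul_ne_zero (mul_ne_zero (mul_ne_zero two_ne_zero hc0') ht0')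
    (mul_ne_zero (pow_ne_zero 2 (ha0 p hp)) (hb0 p hp)) hfin

/-! ### Transfer to manifolds and germs -/

theorem isManifold_real_of_complex (N : Type*) [TopologicalSpace N] [ChartedSpace C3 N]
    [IsManifold 𝓘(ℂ, C3) ω N] : IsManifold 𝓘(ℝ, C3) ∞ N := by
  refine isManifold_of_contDiffOn 𝓘(ℝ, C3) ∞ N fun e e' he he' => ?_
  have h := (contDiffGroupoid ω 𝓘(ℂ, C3)).compatible he he'
  rw [contDiffGroupoid, mem_groupoid_of_pregroupoid] at h
  exact (ContDiffOn.restrict_scalars ℝ h.1).of_le le_top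

/-- The contact hyperplanes are read through the complex derivative of a chart, whereas the
identifying diffeomorphism is only real smooth; the chain rule needs both over ℝ. -/
theorem HasMFDerivAt.restrictScalars_complex {N : Type*} [TopologicalSpace N] [ChartedSpace C3 N]
    {f : N → C3} {y : N} {f' : C3 →L[ℂ] C3} (h : HasMFDerivAt 𝓘(ℂ, C3) 𝓘(ℂ, C3) f y f') :
    HasMFDerivAt 𝓘(ℝ, C3) 𝓘(ℝ, C3) f y (f'.restrictScalars ℝ) :=
  ⟨h.1, h.2.restrictScalars ℝ⟩

/-- The germ of `xi` at any point is not diffeomorphic to one supporting a complex contact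
structure. -/
theorem not_supportsComplexContact {M : Type*} [TopologicalSpace M] [ChartedSpace R6 M]
    [IsManifold 𝓘(ℝ, R6) ∞ M]
    {D : ∀ x : M, Submodule ℝ (TangentSpace 𝓘(ℝ, R6) x)} {q : R6} {p : M}
    (hg : GermDiffeomorphic xi q D p) : ¬ SupportsComplexContact D p := by
  obtain ⟨g, hqg, rfl, hgs, -, hgD⟩ := hg
  rintro ⟨N, _, _, _, H, f, hH, hpf, hfs, -, hfD⟩
  have := isManifold_real_of_complex N
  obtain ⟨V, hV, hyV, -, θ, hθ, -, hθH⟩ := hH (f (g q))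
  set φ := chartAt C3 (f (g q))
  -- This composite in the holomorphic chart is the map F of the local obstruction; `e` supplies its
  -- open domain.
  let e : OpenPartialHomeomorph R6 C3 := (g.trans f).trans φ
  have hU : IsOpen (e.source ∩ e ⁻¹' V) := e.isOpen_inter_preimage hV
  have hmem : ∀ x ∈ e.source ∩ e ⁻¹' V, x ∈ g.source ∧ g x ∈ f.source ∧ f (g x) ∈ φ.source ∧
      φ (f (g x)) ∈ V := by
    rintro x ⟨hx, hxV⟩
    simp only [e, OpenPartialHomeomorph.trans_source, Set.mem_inter_iff, Set.mem_preimage] at hx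
    exact ⟨hx.1.1, hx.1.2, hx.2, hxV⟩
  have hg' : ∀ x ∈ g.source, ContMDiffAt 𝓘(ℝ, R6) 𝓘(ℝ, R6) ∞ g x := fun x hx =>
    hgs.contMDiffAt (g.open_source.mem_nhds hx)
  have hf' : ∀ x ∈ f.source, ContMDiffAt 𝓘(ℝ, R6) 𝓘(ℝ, C3) ∞ f x := fun x hx =>
    hfs.contMDiffAt (f.open_source.mem_nhds hx)
  have hφ' : ∀ y ∈ φ.source, ContMDiffAt 𝓘(ℝ, C3) 𝓘(ℝ, C3) ∞ φ y := fun y hy =>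
    contMDiffOn_chart.contMDiffAt (φ.open_source.mem_nhds hy)
  refine not_ker_pullback_holomorphic hU ⟨q, ?_⟩ (F := fun x => φ (f (g x))) ?_ hV hθ
    (fun x hx => hx.2) ?_
  · refine ⟨?_, hyV⟩
    simp only [e, OpenPartialHomeomorph.trans_source, Set.mem_inter_iff, Set.mem_preimage]
    exact ⟨⟨hqg, hpf⟩, mem_chart_source C3 (f (g q))⟩
  · rw [← contMDiffOn_iff_contDiffOn]
    intro x hx
    obtain ⟨h1, h2, h3, -⟩ := hmem x hx
    exact (((hφ' _ h3).comp (f (g x)) contMDiffAt_id).comp x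
      ((hf' _ h2).comp x (hg' x h1))).contMDiffWithinAt
  · intro x hx v
    obtain ⟨h1, h2, h3, h4⟩ := hmem x hx
    have dg := ((hg' x h1).mdifferentiableAt (by simp)).hasMFDerivAt
    have df := ((hf' _ h2).mdifferentiableAt (by simp)).hasMFDerivAt
    have dφ : HasMFDerivAt 𝓘(ℂ, C3) 𝓘(ℂ, C3) φ (f (g x))
        (mfderiv 𝓘(ℂ, C3) 𝓘(ℂ, C3) φ (f (g x))) :=
      (mdifferentiableAt_atlas (chart_mem_atlas C3 (f (g q))) h3).hasMFDerivAt
    have d := HasMFDerivAt.comp x (dφ.restrictScalars_complex) (HasMFDerivAt.comp x df dg)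
    have d' : fderiv ℝ (fun x => φ (f (g x))) x v = mfderiv 𝓘(ℂ, C3) 𝓘(ℂ, C3) φ (f (g x))
        (mfderiv 𝓘(ℝ, R6) 𝓘(ℝ, C3) f (g x) (mfderiv 𝓘(ℝ, R6) 𝓘(ℝ, R6) g x v)) := by
      rw [← mfderiv_eq_fderiv]
      exact DFunLike.congr_fun d.mfderiv v
    rw [d']
    exact (hgD x h1 v).trans ((hfD _ h2 _).trans (hθH _ h3 h4 _))

theorem germDiffeomorphic_refl (D : R6 → Submodule ℝ R6) (q : R6) :
    GermDiffeomorphic (M := R6) (M' := R6) D q D q := by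
  refine ⟨OpenPartialHomeomorph.refl R6, trivial, rfl, contMDiffOn_id, contMDiffOn_id,
    fun x _ v => ?_⟩
  have : mfderiv 𝓘(ℝ, R6) 𝓘(ℝ, R6) (OpenPartialHomeomorph.refl R6) x v = v := by
    change mfderiv 𝓘(ℝ, R6) 𝓘(ℝ, R6) (id : R6 → R6) x v = v
    rw [mfderiv_id]; rfl
  rw [this]; rfl

end

theorem mainTheorem1 :
    (∀ q : R6,
      IsFatGerm xi q ∧
      HasReebDirections xi ![coordField 4, coordField 5] q ∧
      ∀ (M : Type*) [TopologicalSpace M] [ChartedSpace R6 M] [IsManifold 𝓘(ℝ, R6) ∞ M]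
        (D : ∀ x : M, Submodule ℝ (TangentSpace 𝓘(ℝ, R6) x)) (p : M),
        GermDiffeomorphic xi q D p → ¬ SupportsComplexContact D p) ∧
    ¬ ∀ (D : R6 → Submodule ℝ R6) (q : R6),
        IsFatGerm D q → (∃ Z : Fin 2 → R6 → R6, HasReebDirections D Z q) →
          SupportsComplexContact (M := R6) D q := by 
  refine ⟨fun q => ⟨isFatGerm_xi q, hasReebDirections_xi q, ?_⟩, fun h => ?_⟩
  · intro M _ _ _ D p
    exact not_supportsComplexContact
  · exact not_supportsComplexContact (germDiffeomorphic_refl xi 0)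
      (h xi 0 (isFatGerm_xi 0) ⟨_, hasReebDirections_xi 0⟩)
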